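/- Let $m,n\ge 1$, and let $x^0,\hat x\in\mathbb{R}^n$ be fixed nonzero vectors (the signal and its approximation). Let $$\operatorname{angle}(x^0,\hat x)=\arccos\left(\frac{\langle x^0,\hat x\rangle}{\|x^0\|_2\|\hat x\|_2}\right),\qquad \alpha = 1-\frac{2}{\pi}\operatorname{angle}(x^0,\hat x).$$ Let $a_1,\dots,a_m$ be independent random vectors, each uniformly distributed on the unit sphere $S^{n-1}_{\mathbb{R}}=\{a\in\mathbb{R}^n : \|a\|_2=1\}$, and let $b_i=|\langle a_i,x^0\rangle|$, $i=1,\dots,m$, be the noiseless measurements. PhaseMax is the convex program $$\text{maximize } \langle x,\hat x\rangle \text{ over } x\in\mathbb{R}^n \quad\text{subject to}\quad |\langle a_i,x\rangle|\le b_i,\quad i=1,\dots,m,$$ and it is said to recover $x^0$ if $x^0$ is its unique solution (the unique maximizer). If $\alpha>0$ and $m>2n/\alpha$, then the probability $p_{\mathbb{R}}(m,n)$ that PhaseMax recovers $x^0$ satisfies $$p_{\mathbb{R}}(m,n)\ \ge\ 1-\exp\left(-\frac{(\alpha m-2n)^2}{2m}\right).$$ -/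

import Mathlib

open MeasureTheory ProbabilityTheory

noncomputable section

namespace PhaseMax

/-- Real signals of length `n`, with the `ℓ₂` inner product and norm. -/
abbrev Signal (n : ℕ) : Type := EuclideanSpace ℝ (Fin n)

/-- The unit sphere of `ℝⁿ`. -/
abbrev UnitSphere (n : ℕ) : Type := Metric.sphere (0 : Signal n) 1

/-- The uniform distribution on the unit sphere of `ℝⁿ`: the surface measure induced by Lebesgue
measure, divided by its total mass (a probability measure as soon as `1 ≤ n`). -/
def uniformSphere (n : ℕ) : Measure (UnitSphere n) :=
  ((volume : Measure (Signal n)).toSphere Set.univ)⁻¹ • (volume : Measure (Signal n)).toSphere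

/-- The nonnegative noiseless magnitude measurements `b i = |⟨a i, x₀⟩|`, that is
`(b i)² = |⟨a i, x₀⟩|²`. -/
def measurements {m n : ℕ} (a : Fin m → Signal n) (x₀ : Signal n) : Fin m → ℝ :=
  fun i => |inner ℝ (a i) x₀|

/-- The feasible set of the convex program: all `x` with `|⟨a i, x⟩| ≤ b i` for every `i`. -/
def feasibleSet {m n : ℕ} (a : Fin m → Signal n) (b : Fin m → ℝ) : Set (Signal n) :=
  {x | ∀ i, |inner ℝ (a i) x| ≤ b i}

/-- `x` solves the program "maximize `⟨x, xhat⟩` subject to `|⟨a i, x⟩| ≤ b i` for every `i`". -/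
def IsSolution {m n : ℕ} (a : Fin m → Signal n) (b : Fin m → ℝ) (xhat x : Signal n) : Prop :=
  x ∈ feasibleSet a b ∧ IsMaxOn (fun y => inner ℝ y xhat) (feasibleSet a b) x

/-- PhaseMax with measurement vectors `a` and approximation vector `xhat` recovers `x₀` from its
noiseless measurements: `x₀` is the one and only solution of the program. -/
def Recovers {m n : ℕ} (a : Fin m → Signal n) (xhat x₀ : Signal n) : Prop :=
  ∀ x : Signal n, IsSolution a (measurements a x₀) xhat x ↔ x = x₀

/-- The accuracy `α = 1 - (2/π) · angle(x₀, xhat)` of the approximation vector `xhat`, where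
`angle(x₀, xhat) = arccos (⟨x₀, xhat⟩ / (‖x₀‖ ‖xhat‖))`. -/
def accuracy {n : ℕ} (x₀ xhat : Signal n) : ℝ :=
  1 - 2 / Real.pi * InnerProductGeometry.angle x₀ xhat

end PhaseMax

end

/-! Write `h` for `xhat`. If recovery fails, almost surely there is a unit direction `δ` with `⟨h,
δ⟩ ≥ 0` that no aligned `a i` blocks. Reflection in the line of `h` preserves the uniform law, the
number `⟨h, a⟩` and alignment, so the failure event can be averaged over the `2 ^ m` ways of
reflecting a subset of the vectors.

For fixed `a` in general position, consider the family of subsets whose reflection leaves some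
direction unblocked. Among any `n` aligned vectors one reflection pattern blocks everything
(`InGeneralPosition.exists_flip`), so a shattered set contains fewer than `n` aligned indices. By
Pajor's form of the Sauer–Shelah lemma the family is no larger than the collection of sets it
shatters. Weighting each aligned index by `y ≤ 1` bounds that count by a product
(`InGeneralPosition.pow_mul_card_le`), which independence integrates exactly.

A vector is aligned with probability at least `α`, so a random subset contains on average at least
`α m / 2` aligned indices. Hoeffding's lemma then bounds the chance of seeing at most `n`. -/

noncomputable section

namespace PhaseMax

open scoped Pointwise

/-! ### Reflection in a line, and what failure of recovery implies. -/

section Deterministic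

variable {E : Type*} [NormedAddCommGroup E] [InnerProductSpace ℝ E]

/-- Reflection in the line spanned by `h`. -/
def lineReflection (h : E) : E ≃ₗᵢ[ℝ] E := (ℝ ∙ h).reflection

lemma inner_lineReflection (h a δ : E) :
    inner ℝ (lineReflection h a) δ
      = 2 * (inner ℝ h a * inner ℝ h δ / ‖h‖ ^ 2) - inner ℝ a δ := by
  rw [lineReflection, Submodule.reflection_singleton_apply, inner_sub_left, two_nsmul,
    inner_add_left, inner_smul_left]
  simp
  ring

lemma inner_lineReflection_self {h : E} (a : E) :
    inner ℝ h (lineReflection h a) = inner ℝ h a := by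
  by_cases hh : h = 0
  · simp [hh]
  have : ‖h‖ ^ 2 ≠ 0 := by simpa using hh
  rw [real_inner_comm, inner_lineReflection, real_inner_self_eq_norm_sq, real_inner_comm a h]
  field_simp
  ring

lemma lineReflection_lineReflection (h a : E) : lineReflection h (lineReflection h a) = a :=
  Submodule.reflection_reflection _ _

/-- The vectors for which reflection in the line of `h` does not flip the sign of the
measurement of `x`. -/
def Aligned (x h a : E) : Prop := 0 ≤ inner ℝ x a * inner ℝ x (lineReflection h a)

lemma aligned_lineReflection_iff (x h a : E) :
    Aligned x h (lineReflection h a) ↔ Aligned x h a := by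
  rw [Aligned, Aligned, lineReflection_lineReflection, mul_comm]

/-- For aligned vectors, the measurements of `x` and of `h` have the same sign. -/
lemma Aligned.inner_mul_inner_pos {x h a : E} (ha : Aligned x h a) (hxh : 0 < inner ℝ x h)
    (hx : inner ℝ x a ≠ 0) (hh : inner ℝ h a ≠ 0) : 0 < inner ℝ x a * inner ℝ h a := by
  have h0 : h ≠ 0 := by rintro rfl; simp at hh
  have hn : 0 < ‖h‖ ^ 2 := by positivity
  rw [Aligned, real_inner_comm (lineReflection h a) x, inner_lineReflection,
    real_inner_comm x a, real_inner_comm x h] at ha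
  set s := inner ℝ x a
  set t := inner ℝ h a
  set c := inner ℝ x h
  have hs : 0 < s ^ 2 := by positivity
  have key : 0 < 2 * (c / ‖h‖ ^ 2) * (s * t) := by
    have : s * (2 * (t * c / ‖h‖ ^ 2) - s) = 2 * (c / ‖h‖ ^ 2) * (s * t) - s ^ 2 := by ring
    linarith
  exact pos_of_mul_pos_right key (by positivity)

/-- A nonzero direction which does not decrease the objective `⟨h, ·⟩` and which is not blocked by
the constraints of any of the aligned vectors. -/
def HasUnblockedDirection {ι : Type*} (x h : E) (a : ι → E) : Prop :=
  ∃ δ : E, ‖δ‖ = 1 ∧ 0 ≤ inner ℝ h δ ∧ ∀ i, Aligned x h (a i) → inner ℝ h (a i) * inner ℝ (a i) δ ≤ 0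

end Deterministic

/-- A feasible competitor `y ≠ x₀` gives `δ`, the normalization of `y - x₀`. Feasibility makes `⟨a
i, x₀⟩ * ⟨a i, δ⟩ ≤ 0`, and alignment allows the unknown sign of `⟨a i, x₀⟩` to be replaced by that
of `⟨xhat, a i⟩`. -/
lemma hasUnblockedDirection_of_not_recovers {m n : ℕ} {a : Fin m → Signal n} {x₀ xhat : Signal n}
    (hxh : 0 < inner ℝ x₀ xhat) (hax : ∀ i, inner ℝ x₀ (a i) ≠ 0)
    (hah : ∀ i, inner ℝ xhat (a i) ≠ 0) (hrec : ¬ Recovers a xhat x₀) :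
    HasUnblockedDirection x₀ xhat a := by
  obtain ⟨y, hy, hyne, hyle⟩ : ∃ y ∈ feasibleSet a (measurements a x₀),
      y ≠ x₀ ∧ inner ℝ x₀ xhat ≤ inner ℝ y xhat := by
    by_contra! hcon
    have hx : x₀ ∈ feasibleSet a (measurements a x₀) := fun i => le_rfl
    refine hrec fun x => ⟨fun hxsol => ?_, ?_⟩
    · by_contra hne
      exact absurd (hxsol.2 hx) (not_le.2 (hcon x hxsol.1 hne))
    · rintro rfl
      refine ⟨hx, fun y hy => ?_⟩
      by_cases hyx : y = x
      · simp [hyx]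
      · exact (hcon y hy hyx).le
  have hδ : y - x₀ ≠ 0 := sub_ne_zero.2 hyne
  have hpos : 0 < ‖y - x₀‖ := norm_pos_iff.2 hδ
  refine ⟨‖y - x₀‖⁻¹ • (y - x₀), by simp [norm_smul, hpos.ne'], ?_, fun i hi => ?_⟩
  · rw [inner_smul_right, inner_sub_right, real_inner_comm y, real_inner_comm x₀]
    exact mul_nonneg (by positivity) (by linarith)
  · have hfeas : |inner ℝ (a i) y| ≤ |inner ℝ (a i) x₀| := hy i
    have hsgn := hi.inner_mul_inner_pos hxh (hax i) (hah i)
    rw [real_inner_comm (a i) x₀] at hsgn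
    have h1 : inner ℝ (a i) x₀ * inner ℝ (a i) (y - x₀) ≤ 0 := by
      rw [inner_sub_right, mul_sub]
      have := le_abs_self (inner ℝ (a i) x₀ * inner ℝ (a i) y)
      rw [abs_mul] at this
      nlinarith [abs_nonneg (inner ℝ (a i) x₀), abs_mul_abs_self (inner ℝ (a i) x₀)]
    have h2 : inner ℝ xhat (a i) * inner ℝ (a i) (y - x₀) ≤ 0 := by
      by_contra! hcon
      nlinarith [mul_pos hsgn hcon, mul_self_pos.2 (hah i)]
    rw [inner_smul_right]
    have : inner ℝ xhat (a i) * (‖y - x₀‖⁻¹ * inner ℝ (a i) (y - x₀))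
      = ‖y - x₀‖⁻¹ * (inner ℝ xhat (a i) * inner ℝ (a i) (y - x₀)) := by ring
    rw [this]
    exact mul_nonpos_of_nonneg_of_nonpos (by positivity) h2

/-! ### Measurability of the blocking event. -/

section Measurability

variable {E : Type*} [NormedAddCommGroup E] [InnerProductSpace ℝ E]

lemma isClosed_setOf_aligned (x h : E) : IsClosed {a : E | Aligned x h a} := by
  refine isClosed_le continuous_const ?_
  exact (continuous_const.inner continuous_id).mul
    (continuous_const.inner (lineReflection h).continuous)

/-- The quantifier over `δ` is uncountable, but once the set `K` of aligned indices is fixed the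
conditions on `(δ, a)` are closed, and projecting out the compact unit sphere keeps them closed. -/
lemma measurableSet_setOf_hasUnblockedDirection [FiniteDimensional ℝ E] [MeasurableSpace E]
    [BorelSpace E] {ι : Type*} [Finite ι] (x h : E) :
    MeasurableSet {a : ι → E | HasUnblockedDirection x h a} := by
  have hK : {a : ι → E | HasUnblockedDirection x h a} = ⋃ K : Set ι,
      ({a | ∀ i, Aligned x h (a i) ↔ i ∈ K} ∩
        Prod.snd '' {p : Metric.sphere (0 : E) 1 × (ι → E) | 0 ≤ inner ℝ h (p.1 : E) ∧
          ∀ i ∈ K, inner ℝ h (p.2 i) * inner ℝ (p.2 i) (p.1 : E) ≤ 0}) := by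
    ext a
    simp only [Set.mem_ofPred_eq, Set.mem_iUnion, Set.mem_inter_iff, Set.mem_image, Prod.exists]
    constructor
    · rintro ⟨δ, h1, h2, h3⟩
      exact ⟨{i | Aligned x h (a i)}, fun i => Iff.rfl, ⟨δ, by simpa using h1⟩, a, ⟨h2, h3⟩, rfl⟩
    · rintro ⟨K, hK, δ, a', ⟨h2, h3⟩, rfl⟩
      exact ⟨δ, by simp, h2, fun i hi => h3 i ((hK i).1 hi)⟩
  rw [hK]
  refine MeasurableSet.iUnion fun K => MeasurableSet.inter ?_ (IsClosed.measurableSet ?_)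
  · have : {a : ι → E | ∀ i, Aligned x h (a i) ↔ i ∈ K} =
        ⋂ i, {a : ι → E | Aligned x h (a i) ↔ i ∈ K} := by ext; simp
    rw [this]
    refine MeasurableSet.iInter fun i => ?_
    have hm : MeasurableSet {a : ι → E | Aligned x h (a i)} :=
      (measurable_pi_apply (X := fun _ : ι => E) i) (isClosed_setOf_aligned x h).measurableSet
    by_cases hi : i ∈ K
    · simpa [hi] using hm
    · simp only [hi, iff_false]
      exact hm.compl
  · refine isClosedMap_snd_of_compactSpace _ ?_
    have he : {p : Metric.sphere (0 : E) 1 × (ι → E) | 0 ≤ inner ℝ h (p.1 : E) ∧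
          ∀ i ∈ K, inner ℝ h (p.2 i) * inner ℝ (p.2 i) (p.1 : E) ≤ 0} =
          {p | 0 ≤ inner ℝ h (p.1 : E)} ∩
            ⋂ i ∈ K, {p | inner ℝ h (p.2 i) * inner ℝ (p.2 i) (p.1 : E) ≤ 0} := by
      ext; simp
    rw [he]
    refine (isClosed_le continuous_const (by fun_prop)).inter ?_
    exact isClosed_biInter fun i _ => isClosed_le (by fun_prop) continuous_const

end Measurability

/-! ### Isometry invariance and null sets of the uniform measure. -/

/-- The action of a linear isometry on the unit sphere. -/
def sphereMap {n : ℕ} (L : Signal n ≃ₗᵢ[ℝ] Signal n) (a : UnitSphere n) : UnitSphere n :=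
  ⟨L a, by simp⟩

@[simp] lemma coe_sphereMap {n : ℕ} (L : Signal n ≃ₗᵢ[ℝ] Signal n) (a : UnitSphere n) :
    (sphereMap L a : Signal n) = L a := rfl

lemma measurable_sphereMap {n : ℕ} (L : Signal n ≃ₗᵢ[ℝ] Signal n) : Measurable (sphereMap L) :=
  (L.continuous.measurable.comp measurable_subtype_coe).subtype_mk

/-- Surface measure is, up to a constant, the volume of the cone over a set, and `L` preserves both
cones and volume. -/
lemma measurePreserving_sphereMap {n : ℕ} (L : Signal n ≃ₗᵢ[ℝ] Signal n) :
    MeasurePreserving (sphereMap L) (uniformSphere n) (uniformSphere n) := by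
  refine ⟨measurable_sphereMap L, ?_⟩
  rw [uniformSphere, Measure.map_smul]
  congr 1
  ext s hs
  have hL : L ⁻¹' (Set.Ioo (0 : ℝ) 1 • (Subtype.val '' s)) =
      Set.Ioo (0 : ℝ) 1 • (Subtype.val '' (sphereMap L ⁻¹' s)) := by
    ext y
    simp only [Set.mem_preimage, Set.mem_smul, Set.mem_image]
    constructor
    · rintro ⟨r, hr, _, ⟨b, hb, rfl⟩, h⟩
      refine ⟨r, hr, _, ⟨sphereMap L.symm b, ?_, rfl⟩, L.injective ?_⟩
      · have : sphereMap L (sphereMap L.symm b) = b := by ext1; simp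
        rwa [this]
      · simpa using h
    · rintro ⟨r, hr, _, ⟨b, hb, rfl⟩, rfl⟩
      exact ⟨r, hr, _, ⟨_, hb, rfl⟩, by simp⟩
  rw [Measure.map_apply (measurable_sphereMap L) hs,
    Measure.toSphere_apply' _ (measurable_sphereMap L hs), Measure.toSphere_apply' _ hs, ← hL]
  congr 1
  exact MeasurePreserving.measure_preimage_equiv (f := L.toMeasurableEquiv) L.measurePreserving _

lemma uniformSphere_submodule {n : ℕ} (W : Submodule ℝ (Signal n)) (hW : W ≠ ⊤) :
    uniformSphere n {a | (a : Signal n) ∈ W} = 0 := by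
  have hs : MeasurableSet {a : UnitSphere n | (a : Signal n) ∈ W} :=
    measurable_subtype_coe W.closed_of_finiteDimensional.measurableSet
  rw [uniformSphere, Measure.smul_apply, Measure.toSphere_apply' _ hs]
  have : volume (Set.Ioo (0 : ℝ) 1 • (Subtype.val '' {a : UnitSphere n | (a : Signal n) ∈ W})) = 0 := by
    refine measure_mono_null ?_ (Measure.addHaar_submodule volume W hW)
    rintro _ ⟨r, -, _, ⟨b, hb, rfl⟩, rfl⟩
    exact W.smul_mem r hb
  simp [this]

lemma uniformSphere_inner_eq_zero {n : ℕ} {x : Signal n} (hx : x ≠ 0) :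
    uniformSphere n {a | inner ℝ x (a : Signal n) = 0} = 0 := by
  have h := uniformSphere_submodule (ℝ ∙ x)ᗮ (by
    intro h
    have : x ∈ (ℝ ∙ x)ᗮ := h ▸ Submodule.mem_top
    rw [Submodule.mem_orthogonal_singleton_iff_inner_right] at this
    exact hx (inner_self_eq_zero.1 this))
  simpa only [Submodule.mem_orthogonal_singleton_iff_inner_right] using h

/-! ### General position holds almost surely. -/

/-- A measurable set all of whose sections along one coordinate are null is null for the product
measure. -/
lemma measure_pi_eq_zero_of_update {ι : Type*} [Fintype ι] [DecidableEq ι] {X : ι → Type*}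
    [∀ i, MeasurableSpace (X i)] (μ : ∀ i, Measure (X i)) [∀ i, SigmaFinite (μ i)]
    {A : Set (∀ i, X i)} (hA : MeasurableSet A) (i : ι)
    (h : ∀ a, μ i {x | Function.update a i x ∈ A} = 0) : Measure.pi μ A = 0 := by
  rcases A.eq_empty_or_nonempty with rfl | ⟨a₀, -⟩
  · simp
  have hf : Measurable (A.indicator (1 : (∀ i, X i) → ENNReal)) := measurable_one.indicator hA
  rw [← lintegral_indicator_one hA, lintegral_eq_lmarginal_univ a₀,
    lmarginal_erase' _ hf (Finset.mem_univ i)]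
  have h0 : (fun x => ∫⁻ y, A.indicator (1 : (∀ i, X i) → ENNReal) (Function.update x i y) ∂μ i)
      = fun _ => 0 := by
    funext x
    have hm : MeasurableSet {y | Function.update x i y ∈ A} := measurable_update x hA
    have : (fun y => A.indicator (1 : (∀ i, X i) → ENNReal) (Function.update x i y)) =
      {y | Function.update x i y ∈ A}.indicator 1 := by
      funext y; simp [Set.indicator]
    rw [this, lintegral_indicator_one hm, h x]
  rw [h0]
  simp [lmarginal]

/-- The measurement vectors together with the distinguished vector `h`. -/
abbrev withVector {ι E : Type*} (h : E) (a : ι → E) : Option ι → E := fun o => o.elim h a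

lemma measurableSet_linearIndepOn {n : ℕ} {ι κ : Type*} [Finite κ] (s : Set κ)
    (b : (ι → UnitSphere n) → κ → Signal n) (hb : ∀ k, Measurable fun a => b a k) :
    MeasurableSet {a | LinearIndepOn ℝ (b a) s} := by
  have h := (isOpen_setOfPred_linearIndependent (𝕜 := ℝ) (E := Signal n) (ι := s)).measurableSet
  have hm : Measurable fun (a : ι → UnitSphere n) (k : s) => b a k :=
    measurable_pi_lambda _ fun k => hb k
  exact hm h

/-- Vectors are added one at a time: `h` and the earlier ones span a proper subspace, which the new
independent vector almost surely avoids. -/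
lemma ae_linearIndepOn {n : ℕ} [IsProbabilityMeasure (uniformSphere n)] {ι : Type*} [Fintype ι]
    {h : Signal n} (hh : h ≠ 0) (J : Finset ι) (hJ : J.card < n) :
    ∀ᵐ a ∂(Measure.pi fun _ : ι => uniformSphere n),
      LinearIndepOn ℝ (withVector h fun i => (a i : Signal n)) (insert none (some '' (J : Set ι))) := by
  classical
  induction J using Finset.induction_on with
  | empty => simp [withVector, hh]
  | insert i J hi ih =>
    rw [Finset.card_insert_of_notMem hi] at hJ
    have hmeas : ∀ s : Set (Option ι), MeasurableSet {a : ι → UnitSphere n |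
        LinearIndepOn ℝ (withVector h fun i => (a i : Signal n)) s} := fun s =>
      measurableSet_linearIndepOn s _ fun k => by
        cases k with
        | none => exact measurable_const
        | some k => exact measurable_subtype_coe.comp (measurable_pi_apply k)
    set S : Set (Option ι) := insert none (some '' (J : Set ι)) with hS
    have hins : insert none (some '' ((insert i J : Finset ι) : Set ι)) = insert (some i) S := by
      rw [Finset.coe_insert, Set.image_insert_eq, hS, Set.insert_comm]
    rw [hins]
    have hnull := measure_pi_eq_zero_of_update (fun _ : ι => uniformSphere n)
      ((hmeas S).inter (hmeas (insert (some i) S)).compl) i (fun a => by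
        set W := Submodule.span ℝ (withVector h (fun i => (a i : Signal n)) '' S) with hW
        have hWtop : W ≠ ⊤ := by
          intro htop
          have h1 : Module.finrank ℝ W ≤ J.card + 1 := by
            have : withVector h (fun i => (a i : Signal n)) '' S =
              (((insert none (J.image some)).image (withVector h (fun i => (a i : Signal n))) :
                Finset (Signal n)) : Set (Signal n)) := by simp [hS, Set.image_insert_eq]
            rw [hW, this]
            refine (finrank_span_finset_le_card _).trans (Finset.card_image_le.trans ?_)
            refine (Finset.card_insert_le _ _).trans ?_
            gcongr
            exact Finset.card_image_le
          rw [htop, finrank_top, finrank_euclideanSpace_fin] at h1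
          omega
        refine measure_mono_null ?_ (uniformSphere_submodule W hWtop)
        rintro x ⟨hx1, hx2⟩
        by_contra hxW
        have heq : ∀ o ∈ S, withVector h (fun j => (Function.update a i x j : Signal n)) o =
            withVector h (fun j => (a j : Signal n)) o := by
          rintro o (rfl | ⟨j, hj, rfl⟩)
          · rfl
          · have : j ≠ i := by rintro rfl; exact hi hj
            simp [withVector, this]
        refine hx2 (LinearIndepOn.insert hx1 ?_)
        rw [Set.image_congr heq]
        simpa [withVector] using hxW)
    have hae := ih (by omega)
    rw [ae_iff] at hae ⊢
    refine measure_mono_null ?_ (measure_union_null hae hnull)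
    intro a ha
    by_cases h1 : LinearIndepOn ℝ (withVector h fun i => (a i : Signal n)) S
    · exact Or.inr ⟨h1, ha⟩
    · exact Or.inl h1

/-! ### The probability of being aligned. -/

/-- The condition has period `π / 2` in `t`, so the window may be recentred at `ψ / 2`, where both
cosines are nonnegative within distance `π / 4 - θ / 2`. -/
lemma volume_cos_mul_cos_nonneg {θ : ℝ} (hθ : 0 ≤ θ) (ψ : ℝ) :
    ENNReal.ofReal (Real.pi / 2 - θ) ≤
      volume ({t : ℝ | 0 ≤ Real.cos (2 * t - ψ - θ) * Real.cos (2 * t - ψ + θ)} ∩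
        Set.Ioc 0 (Real.pi / 2)) := by
  set A := {t : ℝ | 0 ≤ Real.cos (2 * t - ψ - θ) * Real.cos (2 * t - ψ + θ)} with hA
  have hpi : 0 < Real.pi / 2 := by positivity
  have hAm : MeasurableSet A := measurableSet_le measurable_const (by fun_prop)
  have hshift : ∀ t, t + Real.pi / 2 ∈ A ↔ t ∈ A := fun t => by
    simp only [hA, Set.mem_ofPred_eq]
    rw [show 2 * (t + Real.pi / 2) - ψ - θ = (2 * t - ψ - θ) + Real.pi by ring,
      show 2 * (t + Real.pi / 2) - ψ + θ = (2 * t - ψ + θ) + Real.pi by ring,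
      Real.cos_add_pi, Real.cos_add_pi, neg_mul_neg]
  have hinv : ∀ g : AddSubgroup.zmultiples (Real.pi / 2), (fun x => g +ᵥ x) ⁻¹' A = A := by
    rintro ⟨_, k, rfl⟩
    ext t
    have hper : Function.Periodic (fun t => t ∈ A) (Real.pi / 2) := fun t => propext (hshift t)
    have := hper.zsmul k t
    change (k • (Real.pi / 2) + t ∈ A) ↔ t ∈ A
    rw [add_comm]
    exact iff_of_eq this
  have hfd := (isAddFundamentalDomain_Ioc hpi 0).measure_set_eq
    (isAddFundamentalDomain_Ioc hpi (ψ / 2 - Real.pi / 4)) hAm hinv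
  rw [zero_add] at hfd
  rw [hfd]
  calc ENNReal.ofReal (Real.pi / 2 - θ)
      = volume (Set.Ioc (ψ / 2 - Real.pi / 4 + θ / 2) (ψ / 2 + Real.pi / 4 - θ / 2)) := by
        rw [Real.volume_Ioc]; congr 1; ring
    _ ≤ _ := by
        refine measure_mono fun t ht => ⟨?_, ?_⟩
        · refine mul_nonneg (Real.cos_nonneg_of_mem_Icc ⟨?_, ?_⟩)
            (Real.cos_nonneg_of_mem_Icc ⟨?_, ?_⟩) <;> linarith [ht.1, ht.2]
        · constructor <;> linarith [ht.1, ht.2]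

/-- Polar coordinates of `x` relative to the direction of `h`. -/
lemma exists_orthonormal_decomposition {E : Type*} [NormedAddCommGroup E] [InnerProductSpace ℝ E]
    {x h : E} (hx : x ≠ 0) (hh : h ≠ 0) (hs : Real.sin (InnerProductGeometry.angle x h) ≠ 0) :
    ∃ u w : E, ‖u‖ = 1 ∧ ‖w‖ = 1 ∧ inner ℝ u w = 0 ∧ h = ‖h‖ • u ∧
      x = ‖x‖ • (Real.cos (InnerProductGeometry.angle x h) • u +
        Real.sin (InnerProductGeometry.angle x h) • w) := by
  set θ := InnerProductGeometry.angle x h with hθ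
  have hhn : ‖h‖ ≠ 0 := norm_ne_zero_iff.2 hh
  have hxn : ‖x‖ ≠ 0 := norm_ne_zero_iff.2 hx
  set u := ‖h‖⁻¹ • h with hu
  have hu1 : ‖u‖ = 1 := by simp [hu, norm_smul, hhn]
  have huu : inner ℝ u u = (1 : ℝ) := by rw [real_inner_self_eq_norm_sq, hu1]; norm_num
  have hux : inner ℝ u x = ‖x‖ * Real.cos θ := by
    rw [hu, inner_smul_left, hθ, InnerProductGeometry.cos_angle, real_inner_comm]
    simp
    field_simp
  set v := x - (‖x‖ * Real.cos θ) • u with hv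
  have huv : inner ℝ u v = (0 : ℝ) := by rw [hv, inner_sub_right, inner_smul_right, huu, hux]; ring
  have hvv : inner ℝ v v = (‖x‖ * Real.sin θ) ^ 2 := by
    have : inner ℝ v v = inner ℝ x v - (‖x‖ * Real.cos θ) * inner ℝ u v := by
      conv_lhs => rw [hv, inner_sub_left, inner_smul_left]
      simp [hv]
    rw [this, huv, hv, inner_sub_right, inner_smul_right, real_inner_comm u x, hux,
      real_inner_self_eq_norm_sq]
    nlinarith [Real.sin_sq_add_cos_sq θ]
  have hvn : ‖v‖ = |‖x‖ * Real.sin θ| := by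
    rw [real_inner_self_eq_norm_sq] at hvv
    rw [← abs_of_nonneg (norm_nonneg v)]
    exact (sq_eq_sq_iff_abs_eq_abs _ _).1 hvv
  have hne : ‖x‖ * Real.sin θ ≠ 0 := mul_ne_zero hxn hs
  refine ⟨u, (‖x‖ * Real.sin θ)⁻¹ • v, hu1, ?_, ?_, ?_, ?_⟩
  · rw [norm_smul, hvn, Real.norm_eq_abs, abs_inv, inv_mul_cancel₀ (abs_ne_zero.2 hne)]
  · rw [inner_smul_right, huv, mul_zero]
  · rw [hu, smul_smul, mul_inv_cancel₀ hhn, one_smul]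
  · rw [smul_add, smul_smul ‖x‖ (Real.cos θ), smul_smul ‖x‖ (Real.sin θ), smul_inv_smul₀ hne, hv]
    abel

/-- The reflection keeps the `u`-coordinate and negates the `w`-coordinate. -/
lemma aligned_iff_of_decomposition {E : Type*} [NormedAddCommGroup E] [InnerProductSpace ℝ E]
    {u w : E} (hu : ‖u‖ = 1) (huw : inner ℝ u w = 0) {r s θ : ℝ} (hr : 0 < r) (hs : 0 < s) (a : E) :
    Aligned (r • (Real.cos θ • u + Real.sin θ • w)) (s • u) a ↔
      0 ≤ (Real.cos θ * inner ℝ u a + Real.sin θ * inner ℝ w a) *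
        (Real.cos θ * inner ℝ u a - Real.sin θ * inner ℝ w a) := by
  have huu : inner ℝ u u = (1 : ℝ) := by rw [real_inner_self_eq_norm_sq, hu]; norm_num
  have hns : ‖s • u‖ = s := by rw [norm_smul, hu, mul_one, Real.norm_of_nonneg hs.le]
  rw [Aligned, real_inner_comm (lineReflection _ a), inner_lineReflection, hns,
    real_inner_comm _ a]
  simp only [inner_smul_left, inner_smul_right, inner_add_left, inner_add_right, huu, huw,
    RCLike.conj_to_real]
  have hs' := hs.ne'
  have : r * (Real.cos θ * inner ℝ u a + Real.sin θ * inner ℝ w a) *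
      (2 * (s * inner ℝ u a * (r * (Real.cos θ * (s * 1) + Real.sin θ * (s * 0))) / s ^ 2) -
        r * (Real.cos θ * inner ℝ u a + Real.sin θ * inner ℝ w a)) =
      r ^ 2 * ((Real.cos θ * inner ℝ u a + Real.sin θ * inner ℝ w a) *
        (Real.cos θ * inner ℝ u a - Real.sin θ * inner ℝ w a)) := by
    field_simp
    ring
  rw [this]
  exact mul_nonneg_iff_of_pos_left (by positivity)

/-- The law of the planar angle of `a` is never computed: the event is averaged over isometries `ρ
t` acting in the `(u, w)`-plane, and Fubini reduces to a bound on the good `t` for each fixed `a`.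
-/
lemma le_uniformSphere_aligned {n : ℕ} [IsProbabilityMeasure (uniformSphere n)]
    {u w : Signal n} (hu : ‖u‖ = 1) (hw : ‖w‖ = 1) (huw : inner ℝ u w = 0) {r s θ : ℝ}
    (hr : 0 < r) (hs : 0 < s) (hθ : 0 ≤ θ) :
    ENNReal.ofReal (Real.pi / 2 - θ) ≤ ENNReal.ofReal (Real.pi / 2) * uniformSphere n
      {a | Aligned (r • (Real.cos θ • u + Real.sin θ • w)) (s • u) (a : Signal n)} := by
  set S := {a : UnitSphere n |
    Aligned (r • (Real.cos θ • u + Real.sin θ • w)) (s • u) (a : Signal n)} with hS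
  have huu : inner ℝ u u = (1 : ℝ) := by rw [real_inner_self_eq_norm_sq, hu]; norm_num
  have hww : inner ℝ w w = (1 : ℝ) := by rw [real_inner_self_eq_norm_sq, hw]; norm_num
  have hwu : inner ℝ w u = (0 : ℝ) := by rw [real_inner_comm, huw]
  have hSm : MeasurableSet S :=
    measurable_subtype_coe (isClosed_setOf_aligned _ _).measurableSet
  -- `f t` is normal to the line at angle `t` in the plane, so `ρ t` sends planar angle `φ` to `2 *
  -- t - φ`.
  set f : ℝ → Signal n := fun t => -Real.sin t • u + Real.cos t • w with hf
  set ρ : ℝ → Signal n ≃ₗᵢ[ℝ] Signal n := fun t => (ℝ ∙ f t)ᗮ.reflection with hρ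
  have hfn : ∀ t, ‖f t‖ ^ 2 = 1 := fun t => by
    rw [← real_inner_self_eq_norm_sq]
    simp only [hf, inner_add_left, inner_add_right, inner_smul_left, inner_smul_right, huu, hww,
      huw, hwu, RCLike.conj_to_real]
    nlinarith [Real.sin_sq_add_cos_sq t]
  have hρa : ∀ t a, ρ t a = a - (2 * inner ℝ (f t) a) • f t := fun t a => by
    have h1 := hfn t
    simp only [hρ]
    rw [Submodule.reflection_orthogonal_apply, Submodule.reflection_singleton_apply]
    simp only [RCLike.ofReal_real_eq_id, id, h1, div_one, two_nsmul, two_mul, add_smul]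
    abel
  have hρu : ∀ t a, inner ℝ u (ρ t a) =
      Real.cos (2 * t) * inner ℝ u a + Real.sin (2 * t) * inner ℝ w a := fun t a => by
    rw [hρa, inner_sub_right, inner_smul_right]
    simp only [hf, inner_add_left, inner_add_right, inner_smul_left, inner_smul_right, huu, huw,
      RCLike.conj_to_real]
    rw [Real.cos_two_mul, Real.sin_two_mul]
    linear_combination (-2 * inner ℝ u a) * Real.sin_sq_add_cos_sq t
  have hρw : ∀ t a, inner ℝ w (ρ t a) =
      Real.sin (2 * t) * inner ℝ u a - Real.cos (2 * t) * inner ℝ w a := fun t a => by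
    rw [hρa, inner_sub_right, inner_smul_right]
    simp only [hf, inner_add_left, inner_add_right, inner_smul_left, inner_smul_right, hww, hwu,
      RCLike.conj_to_real]
    rw [Real.cos_two_mul, Real.sin_two_mul]
    ring
  set T := {p : ℝ × UnitSphere n | sphereMap (ρ p.1) p.2 ∈ S} with hT
  have hmem : ∀ t (a : UnitSphere n), sphereMap (ρ t) a ∈ S ↔
      0 ≤ (Real.cos θ * (Real.cos (2 * t) * inner ℝ u (a : Signal n) +
            Real.sin (2 * t) * inner ℝ w (a : Signal n)) +
          Real.sin θ * (Real.sin (2 * t) * inner ℝ u (a : Signal n) -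
            Real.cos (2 * t) * inner ℝ w (a : Signal n))) *
        (Real.cos θ * (Real.cos (2 * t) * inner ℝ u (a : Signal n) +
            Real.sin (2 * t) * inner ℝ w (a : Signal n)) -
          Real.sin θ * (Real.sin (2 * t) * inner ℝ u (a : Signal n) -
            Real.cos (2 * t) * inner ℝ w (a : Signal n))) := fun t a => by
    rw [hS, Set.mem_ofPred_eq, coe_sphereMap, aligned_iff_of_decomposition hu huw hr hs, hρu, hρw]
  have hTm : MeasurableSet T := by
    simp only [hT, hmem]
    exact (isClosed_le continuous_const (by fun_prop)).measurableSet
  set ν := (volume : Measure ℝ).restrict (Set.Ioc 0 (Real.pi / 2)) with hν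
  have h1 : (ν.prod (uniformSphere n)) T = ENNReal.ofReal (Real.pi / 2) * uniformSphere n S := by
    rw [Measure.prod_apply hTm]
    have : ∀ t, uniformSphere n (Prod.mk t ⁻¹' T) = uniformSphere n S := fun t =>
      (measurePreserving_sphereMap (ρ t)).measure_preimage hSm.nullMeasurableSet
    simp only [this, lintegral_const, hν, Measure.restrict_apply_univ, Real.volume_Ioc, sub_zero]
    rw [mul_comm]
  rw [← h1, Measure.prod_apply_symm hTm]
  calc ENNReal.ofReal (Real.pi / 2 - θ)
      = ∫⁻ _ : UnitSphere n, ENNReal.ofReal (Real.pi / 2 - θ) ∂uniformSphere n := by simp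
    _ ≤ _ := by
      refine lintegral_mono fun a => ?_
      -- Polar coordinates of the projection of `a` to the plane; `z = 0` needs no separate case.
      set z : ℂ := ⟨inner ℝ u (a : Signal n), inner ℝ w (a : Signal n)⟩ with hz
      have hX : inner ℝ u (a : Signal n) = ‖z‖ * Real.cos z.arg := (Complex.norm_mul_cos_arg z).symm
      have hY : inner ℝ w (a : Signal n) = ‖z‖ * Real.sin z.arg := (Complex.norm_mul_sin_arg z).symm
      rw [hν, Measure.restrict_apply (measurable_prodMk_right hTm)]
      refine (volume_cos_mul_cos_nonneg hθ z.arg).trans (measure_mono ?_)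
      refine Set.inter_subset_inter_left _ fun t ht => ?_
      rw [Set.mem_preimage, hT, Set.mem_ofPred_eq, hmem, hX, hY]
      rw [Set.mem_ofPred_eq] at ht
      refine (mul_nonneg (sq_nonneg ‖z‖) ht).trans_eq ?_
      rw [Real.cos_sub (2 * t - z.arg), Real.cos_add (2 * t - z.arg), Real.cos_sub, Real.sin_sub]
      ring

/-- A uniformly distributed vector is aligned with probability at least the accuracy. -/
lemma accuracy_le_uniformSphere_aligned {n : ℕ} [IsProbabilityMeasure (uniformSphere n)]
    {x₀ xhat : Signal n} (hx₀ : x₀ ≠ 0) (hxhat : xhat ≠ 0) :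
    accuracy x₀ xhat ≤ (uniformSphere n).real {a | Aligned x₀ xhat (a : Signal n)} := by
  have hθ0 := InnerProductGeometry.angle_nonneg x₀ xhat
  by_cases hs : Real.sin (InnerProductGeometry.angle x₀ xhat) = 0
  · rcases InnerProductGeometry.sin_eq_zero_iff_angle_eq_zero_or_angle_eq_pi.1 hs with h | h
    · have hall : {a : UnitSphere n | Aligned x₀ xhat (a : Signal n)} = Set.univ := by
        obtain ⟨-, c, hc, rfl⟩ := InnerProductGeometry.angle_eq_zero_iff.1 h
        refine Set.eq_univ_of_forall fun a => ?_
        have h2 : inner ℝ x₀ (lineReflection (c • x₀) (a : Signal n)) = inner ℝ x₀ (a : Signal n) := by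
          have := inner_lineReflection_self (h := c • x₀) (a : Signal n)
          rw [inner_smul_left, inner_smul_left] at this
          exact mul_left_cancel₀ hc.ne' this
        rw [Set.mem_ofPred_eq, Aligned, h2]
        exact mul_self_nonneg _
      rw [hall, accuracy, h]
      simp
    · rw [accuracy, h, div_mul_cancel₀ _ Real.pi_ne_zero]
      exact le_trans (by norm_num) measureReal_nonneg
  · obtain ⟨u, w, hu, hw, huw, hh, hx⟩ := exists_orthonormal_decomposition hx₀ hxhat hs
    have hmain := le_uniformSphere_aligned hu hw huw (norm_pos_iff.2 hx₀) (norm_pos_iff.2 hxhat) hθ0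
    rw [← hx, ← hh] at hmain
    have hfin := measure_ne_top (uniformSphere n) {a | Aligned x₀ xhat (a : Signal n)}
    have h2 := ENNReal.toReal_mono (by finiteness) hmain
    rw [ENNReal.toReal_mul, ENNReal.toReal_ofReal (r := Real.pi / 2) (by positivity),
      ENNReal.toReal_ofReal'] at h2
    have h3 : Real.pi / 2 - InnerProductGeometry.angle x₀ xhat ≤
        Real.pi / 2 * (uniformSphere n).real {a | Aligned x₀ xhat (a : Signal n)} :=
      (le_max_left _ _).trans h2
    rw [accuracy]
    have hpi := Real.pi_pos
    have : 1 - 2 / Real.pi * InnerProductGeometry.angle x₀ xhat =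
        (2 / Real.pi) * (Real.pi / 2 - InnerProductGeometry.angle x₀ xhat) := by field_simp
    rw [this]
    refine (mul_le_mul_of_nonneg_left h3 (by positivity)).trans_eq ?_
    field_simp

/-! ### Blocking patterns and shattering. -/

section Combinatorics

variable {E : Type*} [NormedAddCommGroup E] [InnerProductSpace ℝ E] {ι : Type*}

open scoped Classical in
/-- Reflect the vectors with index in `T` in the line spanned by `h`. -/
def flip (h : E) (T : Finset ι) (a : ι → E) : ι → E :=
  fun i => if i ∈ T then lineReflection h (a i) else a i

lemma aligned_flip_iff (x h : E) (T : Finset ι) (a : ι → E) (i : ι) :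
    Aligned x h (flip h T a i) ↔ Aligned x h (a i) := by
  unfold flip
  split_ifs
  · exact aligned_lineReflection_iff x h (a i)
  · rfl

lemma inner_flip_self (h : E) (T : Finset ι) (a : ι → E) (i : ι) :
    inner ℝ h (flip h T a i) = inner ℝ h (a i) := by
  unfold flip
  split_ifs
  · exact inner_lineReflection_self (a i)
  · rfl

/-- Any `dim E - 1` of the vectors `a i` are linearly independent modulo `h`. -/
def InGeneralPosition (h : E) (a : ι → E) : Prop :=
  ∀ J : Finset ι, J.card < Module.finrank ℝ E →
    LinearIndepOn ℝ (withVector h a) (insert none (some '' (J : Set ι)))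

lemma InGeneralPosition.linearIndepOn_insertNone {h : E} {a : ι → E}
    (hg : InGeneralPosition h a) (J : Finset ι) (hJ : J.card < Module.finrank ℝ E) :
    LinearIndepOn ℝ (withVector h a) (Finset.insertNone J : Set (Option ι)) := by
  have : (Finset.insertNone J : Set (Option ι)) = insert none (some '' (J : Set ι)) := by
    ext o; cases o <;> simp
  rw [this]
  exact hg J hJ

lemma InGeneralPosition.eq_zero_of_inner_eq_zero [FiniteDimensional ℝ E] {h : E} {a : ι → E}
    (hg : InGeneralPosition h a) {J : Finset ι} (hJ : J.card + 1 = Module.finrank ℝ E) {δ : E}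
    (hδ : inner ℝ h δ = 0) (haδ : ∀ i ∈ J, inner ℝ (a i) δ = 0) : δ = 0 := by
  have hli := hg.linearIndepOn_insertNone J (by omega)
  have hspan := LinearIndependent.span_eq_top_of_card_eq_finrank' hli (by simpa using hJ)
  have hδm : δ ∈ Submodule.span ℝ (Set.range fun o : (Finset.insertNone J : Set (Option ι)) =>
      withVector h a o) := hspan ▸ Submodule.mem_top
  have hle : Submodule.span ℝ (Set.range fun o : (Finset.insertNone J : Set (Option ι)) =>
      withVector h a o) ≤ (ℝ ∙ δ)ᗮ := by
    rw [Submodule.span_le]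
    rintro _ ⟨⟨o, ho⟩, rfl⟩
    rw [SetLike.mem_coe, Submodule.mem_orthogonal_singleton_iff_inner_left]
    cases o with
    | none => exact hδ
    | some i => exact haδ i (by simpa using ho)
  have := hle hδm
  rw [Submodule.mem_orthogonal_singleton_iff_inner_left] at this
  exact inner_self_eq_zero.1 this

/-- The relation between `h` and `dim E` vectors in general position. -/
lemma InGeneralPosition.exists_relation [FiniteDimensional ℝ E] {h : E} {a : ι → E}
    (hg : InGeneralPosition h a) {J : Finset ι} (hJ : J.card = Module.finrank ℝ E) :
    ∃ (c₀ : ℝ) (c : ι → ℝ), ∑ i ∈ J, c i • a i = c₀ • h ∧ ∀ i ∈ J, c i ≠ 0 := by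
  classical
  have hnot : ¬ LinearIndepOn ℝ (withVector h a) (Finset.insertNone J : Set (Option ι)) := by
    intro hli
    have := LinearIndependent.fintype_card_le_finrank hli
    simp at this
    omega
  obtain ⟨f, hf, o, ho, hfo⟩ := not_linearIndepOn_finset_iff.1 hnot
  rw [Finset.sum_insertNone] at hf
  refine ⟨-f none, fun i => f (some i), ?_, fun i hi hfi => ?_⟩
  · rw [neg_smul]
    exact eq_neg_of_add_eq_zero_right hf
  -- A vanishing coefficient would leave a nontrivial relation between `h` and only `dim E - 1` of
  -- the vectors.
  · have hli := linearIndepOn_finset_iff.1 (hg.linearIndepOn_insertNone (J.erase i) (by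
      rw [← hJ]; exact Finset.card_erase_lt_of_mem hi)) f (by
        rw [Finset.sum_insertNone, ← hf]
        congr 1
        exact Finset.sum_erase _ (by simp only [hfi, zero_smul]))
    cases o with
    | none => exact hfo (hli none (by simp))
    | some j =>
      by_cases hji : j = i
      · exact hfo (hji ▸ hfi)
      · exact hfo (hli (some j) (by simp [hji]; simpa using ho))

/-- Among the reflections of `dim E` aligned vectors in general position, there is one which blocks
all directions. -/
lemma InGeneralPosition.exists_flip [FiniteDimensional ℝ E] {x h : E}
    {a : ι → E} (hg : InGeneralPosition h a) (hh : h ≠ 0) (hah : ∀ i, inner ℝ h (a i) ≠ 0)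
    {J : Finset ι} (hJ : J.card = Module.finrank ℝ E) (hal : ∀ i ∈ J, Aligned x h (a i)) :
    ∃ T ⊆ J, ∀ U : Finset ι, (∀ i ∈ J, i ∈ U ↔ i ∈ T) →
      ¬ HasUnblockedDirection x h (flip h U a) := by
  classical
  obtain ⟨c₀, c, hsum, hc⟩ := hg.exists_relation hJ
  -- Reflection negates only the part `V i` of `⟨a i, δ⟩` orthogonal to `h`. This choice of signs
  -- turns every constraint into `c i * V i ≤ 0`, while the relation, projected off `h`, forces
  -- these terms to sum to zero. So all vanish, hence `q = 0` and then `δ = 0`.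
  refine ⟨J.filter fun i => c i * inner ℝ h (a i) < 0, Finset.filter_subset _ _, ?_⟩
  rintro U hU ⟨δ, hδ1, hδh, hδ⟩
  have hn : 0 < ‖h‖ ^ 2 := by positivity
  set q := inner ℝ h δ / ‖h‖ ^ 2 with hq
  have hq0 : 0 ≤ q := div_nonneg hδh hn.le
  set V : ι → ℝ := fun i => inner ℝ (a i) δ - inner ℝ h (a i) * q with hV
  have hcon : ∀ i ∈ J, c i * V i ≤ 0 ∧ (V i = 0 → q = 0) := by
    intro i hi
    have hb := hδ i ((aligned_flip_iff x h U a i).2 (hal i hi))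
    rw [inner_flip_self] at hb
    have hmem := hU i hi
    simp only [Finset.mem_filter, hi, true_and] at hmem
    have hs : 0 < inner ℝ h (a i) ^ 2 := by have := hah i; positivity
    have hca : c i * inner ℝ h (a i) ≠ 0 := mul_ne_zero (hc i hi) (hah i)
    have hsq : 0 ≤ inner ℝ h (a i) ^ 2 * q := by positivity
    have hq_of : inner ℝ h (a i) ^ 2 * q ≤ 0 → q = 0 := fun h0 =>
      le_antisymm (by by_contra! h1; nlinarith [mul_pos hs h1]) hq0
    by_cases hiU : i ∈ U
    · have hneg := hmem.1 hiU
      rw [flip, if_pos hiU, inner_lineReflection, mul_div_assoc, ← hq] at hb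
      have hb' : inner ℝ h (a i) ^ 2 * q - inner ℝ h (a i) * V i ≤ 0 := by
        simp only [hV]; linarith
      refine ⟨?_, fun h0 => hq_of (by rw [h0] at hb'; linarith)⟩
      have h1 : 0 ≤ inner ℝ h (a i) * V i := by linarith
      by_contra! h2
      nlinarith [mul_pos h2 hs]
    · have hpos : 0 < c i * inner ℝ h (a i) :=
        lt_of_le_of_ne (not_lt.1 fun hlt => hiU (hmem.2 hlt)) hca.symm
      rw [flip, if_neg hiU] at hb
      have hb' : inner ℝ h (a i) ^ 2 * q + inner ℝ h (a i) * V i ≤ 0 := by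
        simp only [hV]; linarith
      refine ⟨?_, fun h0 => hq_of (by rw [h0] at hb'; linarith)⟩
      have h1 : inner ℝ h (a i) * V i ≤ 0 := by linarith
      by_contra! h2
      nlinarith [mul_pos h2 hs]
  have hVsum : ∑ i ∈ J, c i * V i = 0 := by
    have e1 : ∑ i ∈ J, c i * inner ℝ (a i) δ = c₀ * inner ℝ h δ := by
      have := congrArg (fun y => inner ℝ y δ) hsum
      simpa [sum_inner, inner_smul_left] using this
    have e2 : ∑ i ∈ J, c i * inner ℝ h (a i) = c₀ * ‖h‖ ^ 2 := by
      have := congrArg (fun y => inner ℝ h y) hsum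
      simpa [inner_sum, inner_smul_right] using this
    have e3 : ∑ i ∈ J, c i * V i =
        ∑ i ∈ J, c i * inner ℝ (a i) δ - (∑ i ∈ J, c i * inner ℝ h (a i)) * q := by
      rw [Finset.sum_mul, ← Finset.sum_sub_distrib]
      exact Finset.sum_congr rfl fun i _ => by simp only [hV]; ring
    rw [e3, e1, e2, hq]
    field_simp
    ring
  have hV0 : ∀ i ∈ J, V i = 0 := fun i hi => by
    have := (Finset.sum_eq_zero_iff_of_nonpos fun i hi => (hcon i hi).1).1 hVsum i hi
    exact (mul_eq_zero.1 this).resolve_left (hc i hi)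
  have hnt : Nontrivial E := ⟨h, 0, hh⟩
  have hJne : J.Nonempty := by
    rw [← Finset.card_pos, hJ]; exact Module.finrank_pos
  obtain ⟨i₀, hi₀⟩ := hJne
  have hq' : q = 0 := (hcon i₀ hi₀).2 (hV0 i₀ hi₀)
  have hδ0 : δ = 0 := hg.eq_zero_of_inner_eq_zero (J := J.erase i₀)
    (by rw [Finset.card_erase_add_one hi₀, hJ])
    (by rw [hq] at hq'; exact (div_eq_zero_iff.1 hq').resolve_right hn.ne')
    (fun i hi => by
      have := hV0 i (Finset.mem_of_mem_erase hi)
      simpa [hV, hq'] using this)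
  simp [hδ0] at hδ1

open scoped Classical in
/-- A Chernoff-type bound for the number of reflections which leave a direction unblocked. -/
lemma InGeneralPosition.pow_mul_card_le [Fintype ι] [FiniteDimensional ℝ E] {x h : E}
    {a : ι → E} (hg : InGeneralPosition h a) (hh : h ≠ 0) (hah : ∀ i, inner ℝ h (a i) ≠ 0)
    {y : ℝ} (hy0 : 0 < y) (hy1 : y ≤ 1) :
    y ^ Module.finrank ℝ E *
        ((Finset.univ.filter fun T : Finset ι => HasUnblockedDirection x h (flip h T a)).card : ℝ) ≤
      ∏ i, (1 + if Aligned x h (a i) then y else 1) := by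
  set 𝒜 := Finset.univ.filter fun T : Finset ι => HasUnblockedDirection x h (flip h T a) with h𝒜
  have hsh : ∀ T ∈ 𝒜.shatterer,
      (T.filter fun i => Aligned x h (a i)).card < Module.finrank ℝ E := by
    intro T hT
    rw [Finset.mem_shatterer] at hT
    by_contra! hcard
    obtain ⟨J, hJT, hJ⟩ := Finset.exists_subset_card_eq hcard
    obtain ⟨T', hT'J, hT'⟩ := hg.exists_flip (x := x) hh hah hJ fun i hi =>
      (Finset.mem_filter.1 (hJT hi)).2
    -- Shattering realizes the blocking pattern `T'` on `J` by a member of `𝒜`, a contradiction.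
    obtain ⟨U, hU, hUT⟩ := hT.mono_right (hJT.trans (Finset.filter_subset _ _)) hT'J
    refine hT' U (fun i hi => ?_) (Finset.mem_filter.1 hU).2
    rw [← hUT]
    simp [hi]
  calc y ^ Module.finrank ℝ E * (𝒜.card : ℝ)
      ≤ y ^ Module.finrank ℝ E * (𝒜.shatterer.card : ℝ) := by
        exact mul_le_mul_of_nonneg_left (mod_cast Finset.card_le_card_shatterer 𝒜) (by positivity)
    _ = ∑ T ∈ 𝒜.shatterer, y ^ Module.finrank ℝ E := by
        rw [Finset.sum_const, nsmul_eq_mul, mul_comm]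
    _ ≤ ∑ T ∈ 𝒜.shatterer, ∏ i ∈ T, (if Aligned x h (a i) then y else 1) := by
        refine Finset.sum_le_sum fun T hT => ?_
        rw [Finset.prod_ite, Finset.prod_const, Finset.prod_const_one, mul_one]
        exact pow_le_pow_of_le_one hy0.le hy1 (hsh T hT).le
    _ ≤ ∑ T ∈ (Finset.univ : Finset ι).powerset, ∏ i ∈ T, (if Aligned x h (a i) then y else 1) := by
        refine Finset.sum_le_sum_of_subset_of_nonneg (fun T _ => by simp) fun T _ _ => ?_
        exact Finset.prod_nonneg fun i _ => by split_ifs <;> positivity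
    _ = _ := (Finset.prod_one_add _).symm

end Combinatorics

/-! ### Exponential bound and symmetrization. -/

/-- Hoeffding's lemma for a Bernoulli variable of mean `q`, evaluated at `-t`. -/
lemma one_sub_add_mul_exp_le {q : ℝ} (hq0 : 0 ≤ q) (hq1 : q ≤ 1) (t : ℝ) :
    1 - q + q * Real.exp (-t) ≤ Real.exp (-(q * t) + t ^ 2 / 8) := by
  set μ : Measure ℝ := ENNReal.ofReal (1 - q) • Measure.dirac 0 + ENNReal.ofReal q • Measure.dirac 1
    with hμ
  have hint : ∀ f : ℝ → ℝ, ∫ x, f x ∂μ = (1 - q) * f 0 + q * f 1 := fun f => by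
    have h0 : ∀ c : ℝ, Integrable f (Measure.dirac c) := fun c =>
      integrable_dirac (by simp)
    rw [hμ, integral_add_measure ((h0 0).smul_measure (by simp)) ((h0 1).smul_measure (by simp)),
      integral_smul_measure, integral_smul_measure, integral_dirac, integral_dirac,
      ENNReal.toReal_ofReal hq0, ENNReal.toReal_ofReal (by linarith)]
    rfl
  have hprob : IsProbabilityMeasure μ := ⟨by
    rw [hμ]
    simp only [Measure.add_apply, Measure.smul_apply, measure_univ, smul_eq_mul, mul_one]
    rw [← ENNReal.ofReal_add (by linarith) hq0]
    simp⟩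
  have h := (hasSubgaussianMGF_of_mem_Icc (μ := μ) (X := fun x : ℝ => x) (a := 0) (b := 1)
    aemeasurable_id (by
      rw [hμ, ae_add_measure_iff]
      constructor <;> refine Measure.ae_smul_measure ?_ _ <;> simp [ae_dirac_eq])).mgf_le (-t)
  rw [mgf, hint, hint] at h
  have hnn : ‖(1 : ℝ) - 0‖₊ = 1 := by simp
  rw [hnn] at h
  push_cast at h
  have e1 : (1 - q) * Real.exp (-t * (0 - ((1 - q) * 0 + q * 1))) +
      q * Real.exp (-t * (1 - ((1 - q) * 0 + q * 1))) =
      Real.exp (q * t) * (1 - q + q * Real.exp (-t)) := by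
    rw [show -t * (0 - ((1 - q) * 0 + q * 1)) = q * t by ring,
      show -t * (1 - ((1 - q) * 0 + q * 1)) = q * t + -t by ring, Real.exp_add]
    ring
  rw [e1] at h
  have e2 : Real.exp (-(q * t) + t ^ 2 / 8) =
      Real.exp (-(q * t)) * Real.exp ((1 / 2) ^ 2 * (-t) ^ 2 / 2) := by
    rw [← Real.exp_add]; congr 1; ring
  rw [e2]
  calc 1 - q + q * Real.exp (-t)
      = Real.exp (-(q * t)) * (Real.exp (q * t) * (1 - q + q * Real.exp (-t))) := by
        rw [← mul_assoc, ← Real.exp_add]; simp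
    _ ≤ _ := by gcongr

section Probability

variable {n : ℕ} {ι : Type*} [Fintype ι]

open scoped Classical in
/-- Reflecting some of the vectors preserves the joint law of independent uniform vectors. -/
lemma measurePreserving_flip [IsProbabilityMeasure (uniformSphere n)] (h : Signal n)
    (T : Finset ι) :
    MeasurePreserving
      (fun (a : ι → UnitSphere n) i => if i ∈ T then sphereMap (lineReflection h) (a i) else a i)
      (Measure.pi fun _ => uniformSphere n) (Measure.pi fun _ => uniformSphere n) := by
  have := measurePreserving_pi (fun _ : ι => uniformSphere n) (fun _ : ι => uniformSphere n)
    (f := fun i b => if i ∈ T then sphereMap (lineReflection h) b else b) fun i => by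
      by_cases hi : i ∈ T
      · simpa only [hi, if_true] using measurePreserving_sphereMap (lineReflection h)
      · simp only [hi, if_false]
        exact MeasurePreserving.id (uniformSphere n)
  exact this

lemma measurableSet_unblocked (x h : Signal n) : MeasurableSet
    {a : ι → UnitSphere n | HasUnblockedDirection x h fun i => (a i : Signal n)} := by
  have hm : Measurable fun (a : ι → UnitSphere n) (i : ι) => (a i : Signal n) :=
    measurable_pi_lambda _ fun i => measurable_subtype_coe.comp (measurable_pi_apply i)
  exact hm (measurableSet_setOf_hasUnblockedDirection x h)

lemma ae_inGeneralPosition [IsProbabilityMeasure (uniformSphere n)] {h : Signal n} (hh : h ≠ 0) :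
    ∀ᵐ a ∂(Measure.pi fun _ : ι => uniformSphere n),
      InGeneralPosition h fun i => (a i : Signal n) := by
  unfold InGeneralPosition
  rw [finrank_euclideanSpace_fin, ae_all_iff]
  intro J
  by_cases hJ : J.card < n
  · simpa only [hJ, true_implies] using ae_linearIndepOn hh J hJ
  · simp [hJ]

lemma ae_inner_ne_zero [IsProbabilityMeasure (uniformSphere n)] {h : Signal n} (hh : h ≠ 0) :
    ∀ᵐ a ∂(Measure.pi fun _ : ι => uniformSphere n), ∀ i, inner ℝ h (a i : Signal n) ≠ 0 := by
  rw [ae_all_iff]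
  intro i
  have h0 : ∀ᵐ b : UnitSphere n ∂uniformSphere n, inner ℝ h (b : Signal n) ≠ 0 := by
    rw [ae_iff]
    simpa using uniformSphere_inner_eq_zero hh
  exact (measurePreserving_eval (fun _ : ι => uniformSphere n) i).quasiMeasurePreserving.ae h0

/-- Every reflection pattern preserves the joint law, so `2 ^ card ι` times the probability is the
expected number of unblocked patterns. The pointwise bound on that number is a product of functions
of single vectors. -/
lemma pow_mul_measure_unblocked_le [IsProbabilityMeasure (uniformSphere n)] {x h : Signal n}
    (hh : h ≠ 0) {y : ℝ} (hy0 : 0 < y) (hy1 : y ≤ 1) :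
    y ^ n * (2 ^ Fintype.card ι * (Measure.pi fun _ : ι => uniformSphere n).real
        {a | HasUnblockedDirection x h fun i => (a i : Signal n)}) ≤
      (2 - (1 - y) * (uniformSphere n).real {a | Aligned x h (a : Signal n)}) ^
        Fintype.card ι := by
  classical
  set μ := Measure.pi fun _ : ι => uniformSphere n with hμ
  set B := {a : ι → UnitSphere n | HasUnblockedDirection x h fun i => (a i : Signal n)} with hB
  set S := {a : UnitSphere n | Aligned x h (a : Signal n)} with hS
  have hSm : MeasurableSet S := measurable_subtype_coe (isClosed_setOf_aligned x h).measurableSet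
  have hBm : MeasurableSet B := measurableSet_unblocked x h
  set F : Finset ι → (ι → UnitSphere n) → ι → UnitSphere n := fun T a i =>
    if i ∈ T then sphereMap (lineReflection h) (a i) else a i with hF
  have hFm : ∀ T, MeasurePreserving (F T) μ μ := measurePreserving_flip h
  have hpre : ∀ T, MeasurableSet (F T ⁻¹' B) := fun T => (hFm T).measurable hBm
  have hflip : ∀ T a, F T a ∈ B ↔ HasUnblockedDirection x h (flip h T fun i => (a i : Signal n)) := by
    intro T a
    have : (fun i => (F T a i : Signal n)) = flip h T fun i => (a i : Signal n) := by
      funext i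
      simp only [hF, flip]
      split_ifs <;> rfl
    rw [hB, Set.mem_ofPred_eq, this]
  have hsum : (2 : ℝ) ^ Fintype.card ι * μ.real B =
      ∫ a, ∑ T : Finset ι, (F T ⁻¹' B).indicator (1 : (ι → UnitSphere n) → ℝ) a ∂μ := by
    rw [integral_finsetSum (f := fun T => (F T ⁻¹' B).indicator (1 : (ι → UnitSphere n) → ℝ)) _
      fun T _ => (integrable_const (1 : ℝ)).indicator (hpre T)]
    simp_rw [integral_indicator_one (hpre _)]
    have : ∀ T, μ.real (F T ⁻¹' B) = μ.real B := fun T =>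
      (hFm T).measureReal_preimage hBm.nullMeasurableSet
    simp [this]
  have hprod : (2 - (1 - y) * (uniformSphere n).real S) ^ Fintype.card ι =
      ∫ a : ι → UnitSphere n, ∏ i, (2 + S.indicator (fun _ => y - 1) (a i)) ∂μ := by
    rw [hμ, integral_fintype_prod_eq_prod
      (f := fun (_ : ι) (b : UnitSphere n) => (2 + S.indicator (fun _ => y - 1) b : ℝ)),
      Finset.prod_const, Finset.card_univ]
    congr 1
    have hi : Integrable (S.indicator fun _ => y - 1) (uniformSphere n) :=
      (integrable_const (y - 1)).indicator hSm
    rw [integral_add (f := fun _ => (2 : ℝ)) (integrable_const _) hi,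
      integral_indicator_const _ hSm]
    simp
    ring
  have hint : Integrable (fun a : ι → UnitSphere n =>
      ∏ i, (2 + S.indicator (fun _ => y - 1) (a i))) μ :=
    Integrable.fintype_prod (f := fun (_ : ι) (b : UnitSphere n) =>
      (2 + S.indicator (fun _ => y - 1) b : ℝ)) fun _ =>
        (integrable_const _).add ((integrable_const (y - 1)).indicator hSm)
  rw [hsum, hprod, ← integral_const_mul]
  refine integral_mono_ae ?_ hint ?_
  · exact (integrable_finsetSum _ fun T _ =>
      (integrable_const (1 : ℝ)).indicator (hpre T)).const_mul _
  · filter_upwards [ae_inGeneralPosition hh, ae_inner_ne_zero hh] with a hg hah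
    have key := hg.pow_mul_card_le (x := x) hh hah hy0 hy1
    rw [finrank_euclideanSpace_fin, Finset.card_filter] at key
    push_cast at key
    refine le_trans (le_of_eq ?_) (key.trans (le_of_eq ?_))
    · congr 1
      refine Finset.sum_congr rfl fun T _ => ?_
      simp only [Set.indicator, Set.mem_preimage, hflip, Pi.one_apply]
    · refine Finset.prod_congr rfl fun i _ => ?_
      simp only [Set.indicator, hS, Set.mem_ofPred_eq]
      split_ifs <;> ring

/-- The probability that some direction is left unblocked is exponentially small. -/
lemma measure_unblocked_le [IsProbabilityMeasure (uniformSphere n)] {x h : Signal n} (hh : h ≠ 0)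
    {α : ℝ} (hα0 : 0 ≤ α) (hα : α ≤ (uniformSphere n).real {a | Aligned x h (a : Signal n)})
    (hm : 2 * (n : ℝ) < α * Fintype.card ι) :
    (Measure.pi fun _ : ι => uniformSphere n).real
        {a | HasUnblockedDirection x h fun i => (a i : Signal n)} ≤
      Real.exp (-(α * Fintype.card ι - 2 * n) ^ 2 / (2 * Fintype.card ι)) := by
  have hm0 : (0 : ℝ) < Fintype.card ι := by
    rcases (Nat.cast_nonneg (α := ℝ) (Fintype.card ι)).eq_or_lt with h0 | h0
    · rw [← h0, mul_zero] at hm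
      exact absurd hm (not_lt.2 (by positivity))
    · exact h0
  set M : ℝ := ((Fintype.card ι : ℕ) : ℝ) with hM
  have hα1 : α ≤ 1 := hα.trans measureReal_le_one
  -- The minimizer of the final exponent `n * t + M * (-(α / 2 * t) + t ^ 2 / 8)`.
  set t : ℝ := 2 * (α * M - 2 * n) / M with ht
  have ht0 : 0 < t := div_pos (by linarith) hm0
  set y := Real.exp (-t) with hy
  have hy0 : 0 < y := Real.exp_pos _
  have hy1 : y ≤ 1 := Real.exp_le_one_iff.2 (by linarith)
  have h1 := pow_mul_measure_unblocked_le (ι := ι) (x := x) hh hy0 hy1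
  set b := (Measure.pi fun _ : ι => uniformSphere n).real
        {a | HasUnblockedDirection x h fun i => (a i : Signal n)}
  set p := (uniformSphere n).real {a | Aligned x h (a : Signal n)} with hp
  have hp1 : p ≤ 1 := measureReal_le_one
  have hbase : 2 - (1 - y) * p ≤ 2 * Real.exp (-(α / 2 * t) + t ^ 2 / 8) := by
    -- `α / 2` bounds below the chance that an index is both aligned and in a uniformly random
    -- subset.
    have h2 := one_sub_add_mul_exp_le (q := α / 2) (by positivity) (by linarith) t
    have h3 : (1 - y) * α ≤ (1 - y) * p := mul_le_mul_of_nonneg_left hα (by linarith)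
    rw [← hy] at h2
    linarith
  have hbase0 : 0 ≤ 2 - (1 - y) * p := by nlinarith
  have h4 := h1.trans (pow_le_pow_left₀ hbase0 hbase _)
  rw [mul_pow, mul_left_comm] at h4
  have h5 := le_of_mul_le_mul_left h4 (by positivity)
  rw [hy, ← Real.exp_nat_mul, ← Real.exp_nat_mul, ← hM] at h5
  calc b = Real.exp (n * t) * (Real.exp (n * -t) * b) := by
        rw [← mul_assoc, ← Real.exp_add]; simp
    _ ≤ Real.exp (n * t) * Real.exp (M * (-(α / 2 * t) + t ^ 2 / 8)) := by gcongr
    _ = _ := by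
        rw [← Real.exp_add]
        congr 1
        rw [ht]
        field_simp
        ring

end Probability

end PhaseMax

end

theorem theorem3 {m n : ℕ} {Ω : Type*} [MeasurableSpace Ω]
    (P : MeasureTheory.Measure Ω) [MeasureTheory.IsProbabilityMeasure P]
    (x₀ xhat : PhaseMax.Signal n) (hx₀ : x₀ ≠ 0) (hxhat : xhat ≠ 0)
    (a : Fin m → Ω → PhaseMax.UnitSphere n)
    (ha_meas : ∀ i, Measurable (a i))
    (ha_unif : ∀ i, P.map (a i) = PhaseMax.uniformSphere n)
    (ha_indep : ProbabilityTheory.iIndepFun a P)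
    (hα : 0 < PhaseMax.accuracy x₀ xhat)
    (hm : 2 * (n : ℝ) / PhaseMax.accuracy x₀ xhat < (m : ℝ)) :
    1 - Real.exp (-(PhaseMax.accuracy x₀ xhat * (m : ℝ) - 2 * (n : ℝ)) ^ 2 / (2 * (m : ℝ))) ≤
      P.real {ω | PhaseMax.Recovers (fun i => (a i ω : PhaseMax.Signal n)) xhat x₀} := by
  open PhaseMax in
  have hm' : 2 * (n : ℝ) < accuracy x₀ xhat * m := by rwa [div_lt_iff₀' hα] at hm
  have hm0 : 0 < m := by
    have : (0 : ℝ) < m := lt_of_le_of_lt (by positivity) hm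
    exact_mod_cast this
  -- Read off from the law of one measurement vector, which exists because `m > 0`.
  have hprob : IsProbabilityMeasure (uniformSphere n) := by
    rw [← ha_unif ⟨0, hm0⟩]
    exact Measure.isProbabilityMeasure_map (ha_meas _).aemeasurable
  have hxh : 0 < inner ℝ x₀ xhat := by
    have hlt : InnerProductGeometry.angle x₀ xhat < Real.pi / 2 := by
      rw [accuracy] at hα
      have hpi := Real.pi_pos
      rw [lt_div_iff₀ two_pos]
      have : 2 / Real.pi * InnerProductGeometry.angle x₀ xhat * Real.pi < 1 * Real.pi :=
        mul_lt_mul_of_pos_right (by linarith) hpi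
      field_simp at this
      linarith
    rw [← InnerProductGeometry.cos_angle_mul_norm_mul_norm]
    have hcos := Real.cos_pos_of_mem_Ioo
      ⟨by linarith [InnerProductGeometry.angle_nonneg x₀ xhat, Real.pi_pos], hlt⟩
    have h1 := norm_pos_iff.2 hx₀
    have h2 := norm_pos_iff.2 hxhat
    positivity
  set A : Ω → Fin m → UnitSphere n := fun ω i => a i ω with hA
  have hAm : Measurable A := measurable_pi_lambda _ ha_meas
  have hlaw : P.map A = Measure.pi fun _ => uniformSphere n := by
    rw [hA, ha_indep.map_fun_eq_pi_map fun i => (ha_meas i).aemeasurable]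
    simp_rw [ha_unif]
  have hbound := measure_unblocked_le (ι := Fin m) (x := x₀) hxhat hα.le
    (accuracy_le_uniformSphere_aligned hx₀ hxhat) (by rwa [Fintype.card_fin])
  rw [Fintype.card_fin, ← hlaw, map_measureReal_apply hAm (measurableSet_unblocked _ _)] at hbound
  set R := {ω | Recovers (fun i => (a i ω : Signal n)) xhat x₀} with hR
  have hae : ∀ h : Signal n, h ≠ 0 → ∀ᵐ ω ∂P, ∀ i, inner ℝ h (a i ω : Signal n) ≠ 0 :=
    fun h hh => ae_of_ae_map hAm.aemeasurable (hlaw ▸ ae_inner_ne_zero hh)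
  have hle : P.real Rᶜ ≤ P.real
      (A ⁻¹' {b | HasUnblockedDirection x₀ xhat fun i => (b i : Signal n)}) := by
    refine ENNReal.toReal_mono (measure_ne_top _ _) (measure_mono_ae ?_)
    filter_upwards [hae _ hx₀, hae _ hxhat] with ω h1 h2 h3
    exact hasUnblockedDirection_of_not_recovers hxh h1 h2 h3
  -- Subadditivity suffices, so `R` need not be shown measurable.
  have huniv : (1 : ℝ) ≤ P.real R + P.real Rᶜ := by
    have := measureReal_union_le (μ := P) R Rᶜ
    rwa [Set.union_compl_self, probReal_univ] at this
  linarith
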